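/- Let $H$ be a complex separable Hilbert space and let $\mathcal{G}$ be a countably infinite abelian group of unitary operators on $H$. For a finite list of vectors $X=\{x_1,\dots,x_r\}\subset H$, let $\mathcal{G}(X)$ denote the family $(g x_j)$ indexed by the pairs $(g,j)$, $g\in\mathcal{G}$, $1\le j\le r$. A countable indexed family $(v_n)_{n\in J}$ in $H$ is a Riesz basis for a closed subspace $V$ if $V=\overline{\mathrm{span}}\{v_n\}_{n\in J}$ and there are constants $A,B>0$ such that, for all $(a_n)\in\ell^2(J)$, the series $\sum_n a_nv_n$ converges and $A\sum_n|a_n|^2\le\|\sum_n a_nv_n\|^2\le B\sum_n|a_n|^2$. Two families $(v_n)_{n\in J}$ and $(\tilde v_n)_{n\in J}$ are biorthogonal if $\langle v_n,\tilde v_m\rangle=\delta_{n,m}$ for all $n,m\in J$. Let $X=\{x_1,\dots,x_r\}$, $\tilde X=\{\tilde x_1,\dots,\tilde x_r\}$, $Y=\{y_1,\dots,y_s\}$ and $\tilde Y=\{\tilde y_1,\dots,\tilde y_s\}$ be finite subsets of $H$ with $r<s$. Suppose that $\mathcal{G}(X),\mathcal{G}(\tilde X),\mathcal{G}(Y),\mathcal{G}(\tilde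 Y)$ are Riesz bases for their closed linear spans $V_0,\tilde V_0,V_1,\tilde V_1$ respectively, that $\mathcal{G}(X)$ is biorthogonal to $\mathcal{G}(\tilde X)$ and $\mathcal{G}(Y)$ is biorthogonal to $\mathcal{G}(\tilde Y)$, and that $V_0\subset V_1$ and $\tilde V_0\subset\tilde V_1$. Put $W_0=V_1\cap\tilde V_0^{\perp}$ and $\tilde W_0=\tilde V_1\cap V_0^{\perp}$. Then there exist $\Gamma=\{z_1,\dots,z_{s-r}\}\subset W_0$ and $\tilde\Gamma=\{\tilde z_1,\dots,\tilde z_{s-r}\}\subset\tilde W_0$ such that (i) $\mathcal{G}(\Gamma)$ is a Riesz basis for $W_0$ and $\mathcal{G}(X\cup\Gamma)$ is a Riesz basis for $V_1$; (ii) $\mathcal{G}(\tilde\Gamma)$ is a Riesz basis for $\tilde W_0$, $\mathcal{G}(\tilde X\cup\tilde\Gamma)$ is a Riesz basis for $\tilde V_1$, and $\mathcal{G}(\tilde\Gamma)$ is biorthogonal to $\mathcal{G}(\Gamma)$. Here $X\cup\Gamma$ stands for the list $x_1,\dots,x_r,z_1,\dots,z_{s-r}$, and similarly for $\tilde X\cup\tilde\Gamma$.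 -/

import Mathlib

/-- The indexed family `v` is a Riesz basis for the closed subspace `V`: `V` is the closed linear
span of the family, and there are `A, B > 0` such that for every `a` in `ℓ²(J)` the series
`∑ aₙ vₙ` converges and `A ∑ |aₙ|² ≤ ‖∑ aₙ vₙ‖² ≤ B ∑ |aₙ|²`. -/
def IsRieszBasis {H : Type*} [NormedAddCommGroup H] [InnerProductSpace ℂ H] {J : Type*}
    (v : J → H) (V : Submodule ℂ H) : Prop :=
  V = (Submodule.span ℂ (Set.range v)).topologicalClosure ∧
  ∃ A B : ℝ, 0 < A ∧ 0 < B ∧ ∀ a : lp (fun _ : J => ℂ) 2,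
    Summable (fun n => a n • v n) ∧
    A * ∑' n, ‖a n‖ ^ 2 ≤ ‖∑' n, a n • v n‖ ^ 2 ∧
    ‖∑' n, a n • v n‖ ^ 2 ≤ B * ∑' n, ‖a n‖ ^ 2

open Classical in
/-- Biorthogonality of two families with the same index set: `⟨vₙ, wₘ⟩ = δₙₘ`. -/
def Biorthogonal {H : Type*} [NormedAddCommGroup H] [InnerProductSpace ℂ H] {J : Type*}
    (v w : J → H) : Prop :=
  ∀ n m, inner ℂ (v n) (w m) = if n = m then 1 else 0

/-- For a group `G` of unitary operators on `H` and vectors `x j`, the family `G(X)` of all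
`g (x j)`, indexed by the pairs `(g, j)`. -/
def orbitFamily {H : Type*} [NormedAddCommGroup H] [InnerProductSpace ℂ H]
    (G : Subgroup (H ≃ₗᵢ[ℂ] H)) {ι : Type*} (x : ι → H) : G × ι → H :=
  fun p => (p.1 : H ≃ₗᵢ[ℂ] H) (x p.2)

/-! Each generator `x j` has a synthesis operator `T j : ℓ²(G) → H` with `T j (delta g) = g (x j)`;
let `T'`, `U`, `U'` be those of `x'`, `y`, `y'`. Biorthogonality reads `T'ᵢ† Tⱼ = δᵢⱼ` and `U'ᵢ† Uⱼ
= δᵢⱼ`, and `∑ Uᵢ U'ᵢ†` is the identity on `V₁`. All these operators intertwine the left regular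
representation with the action of `G`, so `X = (U'ᵢ† Tⱼ)` and `L = (T'ᵢ† Uⱼ)` are matrices over its
commutant `C`. The inclusions `V₀ ≤ V₁` and `V₀' ≤ V₁'` give `L X = 1`.

The problem becomes algebraic: `C^s = X C^r ⊕ ker L`, and generators of `W₀` come from a basis of
`ker L`. Since `G` is abelian, `C` is a commutative von Neumann algebra
(`EllTwo.mul_comm_of_mem_centralizer`). Such an algebra has stable range one
(`exists_isUnit_add_mul_of_centralizer`), so free summands cancel (`HasStableRangeOne.cancel_fin`)
and `ker L ≅ C^(s-r)`. This yields `M`, `N` with `X L + M N = 1` and `N M = 1`. The columns of `M`,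
and the adjoints of the rows of `N`, are the coefficients of `z` over `y` and of `z'` over `y'`. -/

/-! ### Cancellation and matrix completion over rings of stable range one. -/

/-- If `F : R × W ≃ R × W'` is linear and its `R → R` corner is a unit, then `W ≃ W'`. -/
theorem nonempty_linearEquiv_of_isUnit_corner {R W W' : Type*} [CommRing R] [AddCommGroup W]
    [AddCommGroup W'] [Module R W] [Module R W'] (F : (R × W) ≃ₗ[R] (R × W'))
    (hu : IsUnit (F (1, 0)).1) : Nonempty (W ≃ₗ[R] W') := by
  obtain ⟨u, hu⟩ := hu
  have hfst : ∀ t w, (F (t, w)).1 = u * t + (F (0, w)).1 := by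
    intro t w
    have : ((t, w) : R × W) = t • (1, 0) + (0, w) := by simp
    rw [this, map_add, map_smul, Prod.fst_add, Prod.smul_fst, ← hu, smul_eq_mul, mul_comm]
  -- The first coordinate of `F (s, w)` vanishes exactly when `s = t w`: the preimage of `0 × W'` is
  -- the graph of `t`, a copy of `W`.
  let t : W →ₗ[R] R :=
    -((u⁻¹ : Rˣ) : R) • (LinearMap.fst R R W' ∘ₗ F.toLinearMap ∘ₗ LinearMap.inr R R W)
  have ht : ∀ w, t w = -(((u⁻¹ : Rˣ) : R) * (F (0, w)).1) := fun w => by simp [t]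
  have h0 : ∀ w, (F (t w, w)).1 = 0 := by
    intro w
    rw [hfst, ht, mul_neg, Units.mul_inv_cancel_left, neg_add_cancel]
  have huniq : ∀ s w, (F (s, w)).1 = 0 → s = t w := by
    intro s w h
    rw [hfst] at h
    rw [ht, ← neg_eq_of_add_eq_zero_right h, ]
    simp
  refine ⟨LinearEquiv.ofLinearMap
    (LinearMap.snd R R W' ∘ₗ F.toLinearMap ∘ₗ (t.prod LinearMap.id))
    (LinearMap.snd R R W ∘ₗ F.symm.toLinearMap ∘ₗ LinearMap.inr R R W') ?_ ?_⟩
  · ext w'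
    have h1 : (F (F.symm (0, w'))).1 = 0 := by simp
    have h2 := huniq (F.symm (0, w')).1 (F.symm (0, w')).2 h1
    simp [← h2]
  · ext w
    have h1 : F (t w, w) = (0, (F (t w, w)).2) := Prod.ext (h0 w) rfl
    simp [← h1]

/-- A commutative ring has stable range one. -/
def HasStableRangeOne (R : Type*) [CommRing R] : Prop :=
  ∀ a a' b : R, a * a' + b = 1 → ∃ e, IsUnit (a + b * e)

/-- Cancellation of a free summand of rank one over a ring of stable range one. -/
theorem HasStableRangeOne.cancel_prod {R W W' : Type*} [CommRing R] (hR : HasStableRangeOne R)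
    [AddCommGroup W] [AddCommGroup W'] [Module R W] [Module R W']
    (F : (R × W) ≃ₗ[R] (R × W')) : Nonempty (W ≃ₗ[R] W') := by
  obtain ⟨p, hp⟩ : ∃ p : R × W, F p = (1, 0) := F.surjective _
  obtain ⟨a', c⟩ := p
  have hsplit : (F (1, 0)).1 * a' + (F (0, c)).1 = 1 := by
    have : ((a', c) : R × W) = a' • (1, 0) + (0, c) := by simp
    rw [this, map_add, map_smul] at hp
    simpa [mul_comm] using congrArg Prod.fst hp
  obtain ⟨e, he⟩ := hR _ _ _ hsplit
  -- The shear sends `(1, 0)` to `(1, e • c)`, so the corner of `S.trans F` is the unit supplied by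
  -- stable range one.
  let S : (R × W) ≃ₗ[R] (R × W) := LinearEquiv.ofLinearMap
    ((LinearMap.fst R R W).prod
      (LinearMap.snd R R W + (LinearMap.toSpanSingleton R W (e • c)) ∘ₗ LinearMap.fst R R W))
    ((LinearMap.fst R R W).prod
      (LinearMap.snd R R W - (LinearMap.toSpanSingleton R W (e • c)) ∘ₗ LinearMap.fst R R W))
    (by ext <;> simp) (by ext <;> simp)
  refine nonempty_linearEquiv_of_isUnit_corner (S.trans F) ?_
  have h1 : S (1, 0) = (1, 0) + e • (0, c) := by simp [S]
  rw [LinearEquiv.trans_apply, h1, map_add, map_smul]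
  simpa [mul_comm] using he

theorem HasStableRangeOne.cancel_fin {R W W' : Type*} [CommRing R] (hR : HasStableRangeOne R)
    [AddCommGroup W] [AddCommGroup W'] [Module R W] [Module R W'] (r : ℕ)
    (F : ((Fin r → R) × W) ≃ₗ[R] ((Fin r → R) × W')) : Nonempty (W ≃ₗ[R] W') := by
  induction r with
  | zero =>
    exact ⟨(LinearEquiv.uniqueProd (R := R) (M := W) (M₂ := Fin 0 → R)).symm ≪≫ₗ F ≪≫ₗ
      LinearEquiv.uniqueProd⟩
  | succ r ih =>
    let c := Fin.consLinearEquiv R (fun _ : Fin (r + 1) => R)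
    obtain ⟨F'⟩ := hR.cancel_prod (W := (Fin r → R) × W) (W' := (Fin r → R) × W')
      ((LinearEquiv.prodAssoc R R (Fin r → R) W).symm ≪≫ₗ (c.prodCongr (.refl R W)) ≪≫ₗ F ≪≫ₗ
        (c.prodCongr (.refl R W')).symm ≪≫ₗ LinearEquiv.prodAssoc R R (Fin r → R) W')
    exact ih F'

/-- Over a ring of stable range one, a matrix with a left inverse can be completed to an invertible
matrix. -/
theorem HasStableRangeOne.exists_matrix_complement {R : Type*} [CommRing R]
    (hR : HasStableRangeOne R) {r s : ℕ} (hrs : r ≤ s) (X : Matrix (Fin s) (Fin r) R)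
    (L : Matrix (Fin r) (Fin s) R) (hLX : L * X = 1) :
    ∃ (Z : Matrix (Fin s) (Fin (s - r)) R) (Z' : Matrix (Fin (s - r)) (Fin s) R),
      X * L + Z * Z' = 1 ∧ Z' * Z = 1 := by
  have hLX' : ∀ v, L.mulVec (X.mulVec v) = v := fun v => by
    rw [Matrix.mulVec_mulVec, hLX, Matrix.one_mulVec]
  let W := LinearMap.ker L.mulVecLin
  obtain ⟨Q, hQ⟩ : ∃ Q : (Fin s → R) →ₗ[R] W,
      ∀ v, (Q v : Fin s → R) = v - X.mulVec (L.mulVec v) :=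
    ⟨(LinearMap.id - X.mulVecLin ∘ₗ L.mulVecLin).codRestrict W (fun v => by
      simp [W, Matrix.mulVec_sub, -Matrix.mulVec_mulVec, hLX']), fun v => rfl⟩
  have hW : ∀ w : W, L.mulVec (w : Fin s → R) = 0 := fun w => w.2
  have hQW : ∀ w : W, Q w = w := fun w => Subtype.ext (by simp [hQ, hW])
  -- `X L` is idempotent, which splits `R^s` as the image of `X` plus `ker L`; `Q` is the projection
  -- `1 - X L`.
  let F₁ : ((Fin r → R) × W) ≃ₗ[R] (Fin s → R) := LinearEquiv.ofLinearMap
    (X.mulVecLin.coprod W.subtype) (L.mulVecLin.prod Q)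
    (LinearMap.ext fun v => by simp [hQ, -Matrix.mulVec_mulVec])
    (LinearMap.ext fun p => by
      refine Prod.ext ?_ (Subtype.ext ?_)
      · simp [Matrix.mulVec_add, -Matrix.mulVec_mulVec, hLX', hW]
      · simp [hQ, -Matrix.mulVec_mulVec, hLX', hQW])
  let F₂ : (Fin s → R) ≃ₗ[R] ((Fin r → R) × (Fin (s - r) → R)) :=
    (LinearEquiv.funCongrLeft R R (finSumFinEquiv.trans (finCongr (Nat.add_sub_cancel' hrs)))) ≪≫ₗ
      LinearEquiv.sumArrowLequivProdArrow _ _ R R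
  obtain ⟨f⟩ := hR.cancel_fin r (F₁ ≪≫ₗ F₂)
  -- `Z` is the inclusion of `ker L` and `Z'` the projection onto it, both read through `f : ker L ≃
  -- R^(s-r)`.
  refine ⟨LinearMap.toMatrix' (W.subtype ∘ₗ f.symm.toLinearMap),
    LinearMap.toMatrix' (f.toLinearMap ∘ₗ Q), ?_, ?_⟩
  · apply Matrix.toLin'.injective
    rw [map_add, Matrix.toLin'_mul, Matrix.toLin'_mul, Matrix.toLin'_toMatrix',
      Matrix.toLin'_toMatrix']
    refine LinearMap.ext fun v => ?_
    simp [hQ, -Matrix.mulVec_mulVec]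
  · apply Matrix.toLin'.injective
    rw [Matrix.toLin'_mul, Matrix.toLin'_toMatrix', Matrix.toLin'_toMatrix']
    refine LinearMap.ext fun v => ?_
    simp [hQW]

/-! ### Stable range one for commutative von Neumann algebras. -/

open ContinuousLinearMap

theorem ContinuousLinearMap.norm_le_of_mul_add_eq_one {E : Type*} [NormedAddCommGroup E]
    [NormedSpace ℂ E] {a a' b : E →L[ℂ] E} (h : a' * a + b = 1)
    (v : E) : ‖v‖ ≤ ‖a'‖ * ‖a v‖ + ‖b v‖ := by
  have hv : v = a' (a v) + b v := by
    rw [← mul_apply_eq_comp, ← add_apply, h, one_apply_eq_self]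
  calc ‖v‖ = ‖a' (a v) + b v‖ := by rw [← hv]
    _ ≤ ‖a' (a v)‖ + ‖b v‖ := norm_add_le _ _
    _ ≤ _ := by gcongr; exact a'.le_opNorm _

section StableRange

variable {E : Type*} [NormedAddCommGroup E] [InnerProductSpace ℂ E] [CompleteSpace E]

theorem ContinuousLinearMap.norm_star_apply_of_commute {u : E →L[ℂ] E} (hu : Commute (star u) u)
    (v : E) : ‖star u v‖ = ‖u v‖ := by
  have h : inner ℂ (star u v) (star u v) = inner ℂ (u v) (u v) := by
    rw [star_eq_adjoint, adjoint_inner_left, ← adjoint_inner_right, ← star_eq_adjoint,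
      ← mul_apply_eq_comp, ← mul_apply_eq_comp, hu.eq]
  rw [inner_self_eq_norm_sq_to_K, inner_self_eq_norm_sq_to_K] at h
  have h2 : ‖star u v‖ ^ 2 = ‖u v‖ ^ 2 := by exact_mod_cast h
  exact (pow_left_inj₀ (norm_nonneg _) (norm_nonneg _) two_ne_zero).1 h2

/-- The bound makes `star u * u` coercive, hence invertible, and a product of commuting factors is a
unit only if each factor is. -/
theorem ContinuousLinearMap.isUnit_of_commute_star_of_bound {u : E →L[ℂ] E}
    (hu : Commute (star u) u) {c : ℝ} (hc : 0 < c) (h : ∀ v, c * ‖v‖ ^ 2 ≤ ‖u v‖ ^ 2) :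
    IsUnit u := by
  lift c to NNReal using hc.le
  have : IsUnit (star u * u) := by
    refine isUnit_of_forall_le_norm_inner_map (star u * u) (c := c) (by exact_mod_cast hc) fun v => ?_
    rw [mul_apply_eq_comp, star_eq_adjoint, adjoint_inner_left, inner_self_eq_norm_sq_to_K]
    rw [mul_comm]
    simpa using h v
  exact (hu.isUnit_mul_iff.1 this).2

/-- For a selfadjoint `T`, the operator is nonpositive on the kernel of its positive part and
nonnegative on the orthogonal complement of that kernel. -/
theorem ContinuousLinearMap.re_inner_nonpos_of_posPart_eq_zero {T : E →L[ℂ] E}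
    (hT : IsSelfAdjoint T) {v : E} (hv : T⁺ v = 0) : (inner ℂ (T v) v).re ≤ 0 := by
  have h := CFC.posPart_sub_negPart T hT
  have hp := ((nonneg_iff_isPositive _).1 (CFC.negPart_nonneg T)).re_inner_nonneg_left v
  rw [← h, sub_apply, hv, zero_sub, inner_neg_left]
  simpa using hp

theorem ContinuousLinearMap.re_inner_nonneg_of_mem_ker_posPart_orthogonal {T : E →L[ℂ] E}
    (hT : IsSelfAdjoint T) {v : E} (hv : v ∈ (LinearMap.ker T⁺.toLinearMap)ᗮ) :
    0 ≤ (inner ℂ (T v) v).re := by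
  have h := CFC.posPart_sub_negPart T hT
  have hp := ((nonneg_iff_isPositive _).1 (CFC.posPart_nonneg T)).re_inner_nonneg_left v
  have hn := (nonneg_iff_isPositive _).1 (CFC.negPart_nonneg T)
  have h0 : T⁻ v = 0 := by
    -- Since `T⁺ T⁻ = 0`, the range of `T⁻` lies in `ker T⁺`; pairing `T⁻ (T⁻ v)` with `v` then
    -- gives `‖T⁻ v‖² = 0`.
    have hmem : T⁻ (T⁻ v) ∈ LinearMap.ker T⁺.toLinearMap := by
      change (T⁺ * T⁻) (T⁻ v) = 0
      rw [CFC.posPart_mul_negPart, zero_apply]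
    have := hv _ hmem
    rw [hn.inner_left_eq_inner_right] at this
    exact inner_self_eq_zero.1 this
  rw [← h, sub_apply, h0, sub_zero]
  exact hp

theorem Submodule.commute_starProjection {K : Submodule ℂ E} [K.HasOrthogonalProjection]
    {u : E →L[ℂ] E} (h : ∀ v ∈ K, u v ∈ K) (h' : ∀ v ∈ K, star u v ∈ K) :
    Commute u K.starProjection := by
  ext v
  rw [mul_apply_eq_comp, mul_apply_eq_comp]
  refine (Submodule.eq_starProjection_of_mem_orthogonal
    (h _ (K.starProjection_apply_mem v)) ?_).symm
  rw [← map_sub]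
  intro w hw
  rw [← adjoint_inner_left]
  exact K.sub_starProjection_mem_orthogonal v _ (h' w hw)

/-- Projections in the von Neumann algebra `Sᶜ` separate the selfadjoint `T ∈ Sᶜ` into its
nonpositive and nonnegative parts. -/
theorem exists_starProjection_mem_centralizer {S : Set (E →L[ℂ] E)} (hS : ∀ u ∈ S, star u ∈ S)
    {T : E →L[ℂ] E} (hT : IsSelfAdjoint T) (hTS : T ∈ S.centralizer) :
    ∃ (K : Submodule ℂ E) (_ : K.HasOrthogonalProjection), K.starProjection ∈ S.centralizer ∧
      (∀ v ∈ K, (inner ℂ (T v) v).re ≤ 0) ∧ ∀ v ∈ Kᗮ, 0 ≤ (inner ℂ (T v) v).re := by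
  have hK : IsClosed ((LinearMap.ker T⁺.toLinearMap : Submodule ℂ E) : Set E) :=
    ContinuousLinearMap.isClosed_ker T⁺
  have : CompleteSpace (LinearMap.ker T⁺.toLinearMap) := hK.completeSpace_coe
  have hinv : ∀ u ∈ S, ∀ v ∈ LinearMap.ker T⁺.toLinearMap,
      u v ∈ LinearMap.ker T⁺.toLinearMap := by
    intro u hu v hv
    -- `T⁺` is a continuous function of `T`, so it commutes with whatever commutes with `T`.
    have hc : Commute T⁺ u := by
      rw [CFC.posPart_def]
      exact Commute.cfcₙ_real (hTS u hu).symm _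
    change (T⁺ * u) v = 0
    rw [hc.eq, mul_apply_eq_comp]
    change u (T⁺.toLinearMap v) = 0
    rw [LinearMap.mem_ker.1 hv, map_zero]
  refine ⟨LinearMap.ker T⁺.toLinearMap, inferInstance, fun u hu => ?_, fun v hv => ?_,
    fun v hv => re_inner_nonneg_of_mem_ker_posPart_orthogonal hT hv⟩
  · exact Submodule.commute_starProjection (hinv u hu) (hinv _ (hS u hu))
  · exact re_inner_nonpos_of_posPart_eq_zero hT hv

theorem star_mem_centralizer_of_star_mem {S : Set (E →L[ℂ] E)} (hS : ∀ u ∈ S, star u ∈ S)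
    {a : E →L[ℂ] E} (ha : a ∈ S.centralizer) : star a ∈ S.centralizer := fun u hu => by
  have := congrArg star (ha (star u) (hS u hu))
  simpa using this.symm

/-- A commutative von Neumann algebra has stable range one. -/
theorem exists_isUnit_add_mul_of_centralizer {S : Set (E →L[ℂ] E)} (hS : ∀ u ∈ S, star u ∈ S)
    (hcomm : ∀ a ∈ S.centralizer, ∀ b ∈ S.centralizer, a * b = b * a) {a a' b : E →L[ℂ] E}
    (ha : a ∈ S.centralizer) (ha' : a' ∈ S.centralizer) (hb : b ∈ S.centralizer)
    (h : a * a' + b = 1) : ∃ e ∈ S.centralizer, IsUnit (a + b * e) := by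
  have hstar : ∀ c ∈ S.centralizer, star c ∈ S.centralizer := fun c =>
    star_mem_centralizer_of_star_mem hS
  -- The spectral cut of `a†a - b†b` at zero gives `‖a v‖ ≤ ‖b v‖` on `K` and the reverse on `Kᗮ`.
  -- As `a' a + b = 1`, the larger of the two is at least `‖v‖ / M`.
  obtain ⟨K, _, hKS, hK, hK'⟩ := exists_starProjection_mem_centralizer hS
    (T := star a * a - star b * b) ((IsSelfAdjoint.star_mul_self a).sub (.star_mul_self b))
    (Subring.sub_mem (Subring.centralizer S) (Set.mul_mem_centralizer (hstar a ha) ha)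
      (Set.mul_mem_centralizer (hstar b hb) hb))
  set P := K.starProjection with hP
  have hre : ∀ v, (inner ℂ ((star a * a - star b * b) v) v).re = ‖a v‖ ^ 2 - ‖b v‖ ^ 2 := by
    intro v
    rw [sub_apply, mul_apply_eq_comp, mul_apply_eq_comp, inner_sub_left, star_eq_adjoint, star_eq_adjoint,
      adjoint_inner_left, adjoint_inner_left, inner_self_eq_norm_sq_to_K,
      inner_self_eq_norm_sq_to_K, Complex.sub_re]
    norm_cast
  have hbound := norm_le_of_mul_add_eq_one (a := a) (a' := a') (b := b)
    (by rw [hcomm _ ha' _ ha, h])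
  set M := ‖a'‖ + 1 with hM
  have hM1 : 1 ≤ M := by simp [hM]
  have hbK : ∀ v ∈ K, ‖v‖ ≤ M * ‖b v‖ := by
    intro v hv
    have h1 : ‖a v‖ ≤ ‖b v‖ := by
      have := hK v hv
      rw [hre, sub_nonpos] at this
      exact le_of_sq_le_sq this (norm_nonneg _)
    have := hbound v
    nlinarith [norm_nonneg a']
  have haK : ∀ v ∈ Kᗮ, ‖v‖ ≤ M * ‖a v‖ := by
    intro v hv
    have h1 : ‖b v‖ ≤ ‖a v‖ := by
      have := hK' v hv
      rw [hre, sub_nonneg] at this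
      exact le_of_sq_le_sq this (norm_nonneg _)
    have := hbound v
    nlinarith [norm_nonneg a']
  -- With `e = l P b†`, the operator `u = a + b e` equals `a` on `Kᗮ` and `a + l b b†` on `K`. There
  -- `‖b b† v‖ ≥ ‖v‖ / M²`, so this `l` makes the second term at least `(‖a‖ + 1) ‖v‖` and leaves
  -- `‖u v‖ ≥ ‖v‖`.
  set l : ℝ := M ^ 2 * (‖a‖ + 1) with hl
  have hl0 : 0 ≤ l := by positivity
  have hPb : P * star b ∈ S.centralizer := Set.mul_mem_centralizer hKS (hstar b hb)
  have he : (l : ℂ) • (P * star b) ∈ S.centralizer := fun u hu => by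
    rw [mul_smul_comm, hPb u hu, smul_mul_assoc]
  refine ⟨_, he, ?_⟩
  set u := a + b * ((l : ℂ) • (P * star b)) with hu
  have huS : u ∈ S.centralizer := Set.add_mem_centralizer ha (Set.mul_mem_centralizer hb he)
  have hu_apply : ∀ v, u v = a v + (l : ℂ) • b (P (star b v)) := fun v => by simp [hu]
  have hPc : ∀ c ∈ S.centralizer, ∀ v, P (c v) = c (P v) := fun c hc v => by
    rw [← mul_apply_eq_comp, hcomm _ hKS _ hc, mul_apply_eq_comp]
  have hinvK : ∀ c ∈ S.centralizer, ∀ v ∈ K, c v ∈ K := fun c hc v hv => by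
    rw [← Submodule.starProjection_eq_self_iff, ← hP, hPc c hc, hP,
      Submodule.starProjection_eq_self_iff.2 hv]
  have huK : ∀ v ∈ K, ‖v‖ ≤ M * ‖u v‖ := by
    intro v hv
    have h1 : P (star b v) = star b v :=
      Submodule.starProjection_eq_self_iff.2 (hinvK _ (hstar b hb) v hv)
    have h2 := hbK _ (hinvK _ (hstar b hb) v hv)
    rw [norm_star_apply_of_commute (hcomm _ (hstar b hb) _ hb)] at h2
    have h3 := hbK v hv
    have h4 : ‖v‖ ≤ M ^ 2 * ‖b (star b v)‖ := by nlinarith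
    have h5 : l * ‖b (star b v)‖ ≤ ‖u v‖ + ‖a v‖ := by
      have : (l : ℂ) • b (star b v) = u v - a v := by rw [hu_apply, h1]; abel
      calc l * ‖b (star b v)‖ = ‖(l : ℂ) • b (star b v)‖ := by
            rw [norm_smul, Complex.norm_real, Real.norm_of_nonneg hl0]
        _ ≤ _ := by rw [this]; exact norm_sub_le _ _
    have h6 := a.le_opNorm v
    have h7 : ‖v‖ ≤ ‖u v‖ := by
      have : (‖a‖ + 1) * ‖v‖ ≤ (‖a‖ + 1) * (M ^ 2 * ‖b (star b v)‖) := by gcongr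
      rw [hl] at h5
      linarith
    nlinarith [norm_nonneg (u v)]
  have huK' : ∀ v ∈ Kᗮ, ‖v‖ ≤ M * ‖u v‖ := by
    intro v hv
    have h1 : P (star b v) = 0 := by
      rw [hPc _ (hstar b hb), hP, (Submodule.starProjection_apply_eq_zero_iff K).2 hv, map_zero]
    have := haK v hv
    rwa [hu_apply, h1, map_zero, smul_zero, add_zero]
  have hM0 : 0 < M := one_pos.trans_le hM1
  refine isUnit_of_commute_star_of_bound (hcomm _ (hstar u huS) _ huS) (c := (M ^ 2)⁻¹)
    (by positivity) fun v => ?_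
  -- `u` commutes with `P`, so the bounds on `K` and `Kᗮ` add up by Pythagoras.
  rw [inv_mul_le_iff₀ (by positivity), Submodule.norm_sq_eq_add_norm_sq_starProjection v K,
    Submodule.norm_sq_eq_add_norm_sq_starProjection (u v) K]
  have h1 := huK (P v) (K.starProjection_apply_mem v)
  have h2 := huK' (Kᗮ.starProjection v) (Kᗮ.starProjection_apply_mem v)
  have h3 : Kᗮ.starProjection (u v) = u (Kᗮ.starProjection v) := by
    rw [Submodule.starProjection_orthogonal_val, Submodule.starProjection_orthogonal_val, ← hP,
      hPc u huS, map_sub]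
  rw [h3, ← hP, hPc u huS, mul_add, ← mul_pow, ← mul_pow]
  gcongr

end StableRange

/-! ### The space `ℓ²(J)` and the commutant of the regular representation. -/

/-- The Hilbert space `ℓ²(J)` of square summable complex families. -/
noncomputable abbrev EllTwo (J : Type*) := lp (fun _ : J => ℂ) 2

namespace EllTwo

variable {J K : Type*}

open Classical in
/-- The standard orthonormal basis of `ℓ²(J)`. -/
noncomputable def delta (j : J) : EllTwo J := lp.single 2 j (1 : ℂ)

open Classical in
theorem delta_apply (j k : J) : delta j k = if j = k then 1 else 0 := by
  rw [delta, lp.single_apply, Pi.single_apply]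
  simp only [eq_comm]

theorem inner_delta_left (j : J) (a : EllTwo J) : inner ℂ (delta j) a = a j := by
  classical
  rw [delta, lp.inner_single_left]
  simp

theorem hasSum_smul_delta (a : EllTwo J) : HasSum (fun j => a j • delta j) a := by
  classical
  convert lp.hasSum_single (p := 2) (by simp) a using 2 with j
  rw [delta, ← lp.single_smul, smul_eq_mul, mul_one]

theorem hasSum_apply {F : Type*} [AddCommMonoid F] [Module ℂ F] [TopologicalSpace F]
    (T : EllTwo J →L[ℂ] F) (a : EllTwo J) : HasSum (fun j => a j • T (delta j)) (T a) := by
  simpa using (hasSum_smul_delta a).mapL T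

theorem clm_ext {F : Type*} [AddCommMonoid F] [Module ℂ F] [TopologicalSpace F] [T2Space F]
    {T S : EllTwo J →L[ℂ] F} (h : ∀ j, T (delta j) = S (delta j)) : T = S := by
  ext a
  refine (hasSum_apply T a).unique ?_
  simp only [h]
  exact hasSum_apply S a

theorem ext_inner {a b : EllTwo J} (h : ∀ j, inner ℂ (delta j) a = inner ℂ (delta j) b) :
    a = b := by
  ext j
  simpa [inner_delta_left] using h j

theorem apply_mem_of_isClosed {H : Type*} [NormedAddCommGroup H] [NormedSpace ℂ H]
    {V : Submodule ℂ H} (hV : IsClosed (V : Set H)) {T : EllTwo J →L[ℂ] H}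
    (h : ∀ j, T (delta j) ∈ V) (a : EllTwo J) : T a ∈ V :=
  hV.mem_of_tendsto (hasSum_apply T a)
    (.of_forall fun _ => V.sum_mem fun j _ => V.smul_mem _ (h j))

theorem hasSum_norm_sq (a : EllTwo J) : HasSum (fun j => ‖a j‖ ^ 2) (‖a‖ ^ 2) := by
  have := lp.hasSum_norm (p := 2) (by simp) a
  simpa using this

/-- Restriction of a square summable family along an injective map of index sets. -/
noncomputable def comap (φ : K → J) (hφ : φ.Injective) : EllTwo J →L[ℂ] EllTwo K :=
  LinearMap.mkContinuous
    { toFun := fun a => ⟨fun k => a (φ k), memℓp_gen (by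
        have h := (hasSum_norm_sq a).summable.comp_injective hφ
        simpa [Function.comp_def] using h)⟩
      map_add' := fun a b => rfl
      map_smul' := fun c a => rfl } 1 (fun a => by
    rw [one_mul, ← sq_le_sq₀ (norm_nonneg _) (norm_nonneg _)]
    rw [← (hasSum_norm_sq a).tsum_eq, ← (hasSum_norm_sq _).tsum_eq]
    exact tsum_comp_le_tsum_of_inj (hasSum_norm_sq a).summable (fun _ => by positivity) hφ)

theorem comap_apply {φ : K → J} (hφ : φ.Injective) (a : EllTwo J) (k : K) :
    comap φ hφ a k = a (φ k) := rfl

theorem adjoint_comap_delta {φ : K → J} (hφ : φ.Injective) (k : K) :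
    adjoint (comap φ hφ) (delta k) = delta (φ k) := by
  refine ext_inner_right ℂ fun a => ?_
  rw [adjoint_inner_left, inner_delta_left, inner_delta_left, comap_apply]

section Translation

variable {G : Type*} [Group G]

/-- The left regular representation on `ℓ²(G)`. -/
noncomputable def translation (g : G) : EllTwo G →L[ℂ] EllTwo G :=
  comap (fun h => g⁻¹ * h) (mul_right_injective g⁻¹)

theorem translation_apply (g : G) (a : EllTwo G) (h : G) : translation g a h = a (g⁻¹ * h) := rfl

theorem translation_delta (g h : G) : translation g (delta h) = delta (g * h) := by
  ext k
  rw [translation_apply, delta_apply, delta_apply]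
  classical exact if_congr eq_inv_mul_iff_mul_eq rfl rfl

theorem adjoint_translation (g : G) : adjoint (translation g) = translation g⁻¹ :=
  clm_ext fun h => by rw [translation_delta, translation, adjoint_comap_delta]

theorem apply_delta_of_mem_centralizer {a : EllTwo G →L[ℂ] EllTwo G}
    (ha : a ∈ (Set.range (translation (G := G))).centralizer) (g : G) :
    a (delta g) = translation g (a (delta 1)) := by
  have := ha _ ⟨g, rfl⟩
  rw [← mul_apply_eq_comp, this, mul_apply_eq_comp, translation_delta, mul_one]

/-- The commutant of the regular representation of an abelian group is commutative. -/
theorem mul_comm_of_mem_centralizer (hG : ∀ g h : G, g * h = h * g)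
    {a b : EllTwo G →L[ℂ] EllTwo G}
    (ha : a ∈ (Set.range (translation (G := G))).centralizer)
    (hb : b ∈ (Set.range (translation (G := G))).centralizer) : a * b = b * a := by
  -- Applied to `delta 1`, a product in the commutant is a convolution, which is symmetric for
  -- abelian `G`; the value at `delta 1` determines the operator.
  have key : ∀ c d : EllTwo G →L[ℂ] EllTwo G,
      c ∈ (Set.range (translation (G := G))).centralizer → ∀ g : G,
      HasSum (fun h => d (delta 1) h * c (delta 1) (h⁻¹ * g)) ((c * d) (delta 1) g) := by
    intro c d hc g
    have h1 := (hasSum_apply c (d (delta 1))).mapL (innerSL ℂ (delta g))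
    have hc' : ∀ h, c (delta h) g = c (delta 1) (h⁻¹ * g) := fun h => by
      rw [apply_delta_of_mem_centralizer hc h, translation_apply]
    simp only [innerSL_apply_apply, inner_smul_right, inner_delta_left, hc'] at h1
    exact h1
  have h1 : (a * b) (delta 1) = (b * a) (delta 1) := by
    ext g
    refine (key a b ha g).unique ?_
    have h2 := key b a hb g
    let e : G ≃ G := ⟨fun h => h⁻¹ * g, fun h => g * h⁻¹, fun h => by simp, fun h => by simp⟩
    rw [← e.hasSum_iff] at h2
    convert h2 using 2 with h
    have : (h⁻¹ * g)⁻¹ * g = h := by rw [mul_inv_rev, inv_inv, mul_assoc, hG h g]; simp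
    simp only [Function.comp_apply, e, Equiv.coe_fn_mk, this]
    exact mul_comm _ _
  refine clm_ext fun g => ?_
  rw [apply_delta_of_mem_centralizer (Set.mul_mem_centralizer ha hb), h1,
    ← apply_delta_of_mem_centralizer (Set.mul_mem_centralizer hb ha)]

theorem star_mem_range_translation {u : EllTwo G →L[ℂ] EllTwo G}
    (hu : u ∈ Set.range (translation (G := G))) : star u ∈ Set.range (translation (G := G)) := by
  obtain ⟨g, rfl⟩ := hu
  exact ⟨g⁻¹, by rw [star_eq_adjoint, adjoint_translation]⟩

/-- A left invertible matrix of operators commuting with the regular representation of an abelian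
group can be completed to an invertible one. -/
theorem exists_matrix_complement (hG : ∀ g h : G, g * h = h * g) {r s : ℕ} (hrs : r ≤ s)
    (X : Matrix (Fin s) (Fin r) (EllTwo G →L[ℂ] EllTwo G))
    (L : Matrix (Fin r) (Fin s) (EllTwo G →L[ℂ] EllTwo G))
    (hX : ∀ i j, X i j ∈ (Set.range (translation (G := G))).centralizer)
    (hL : ∀ i j, L i j ∈ (Set.range (translation (G := G))).centralizer) (hLX : L * X = 1) :
    ∃ (Z : Matrix (Fin s) (Fin (s - r)) (EllTwo G →L[ℂ] EllTwo G))
      (Z' : Matrix (Fin (s - r)) (Fin s) (EllTwo G →L[ℂ] EllTwo G)),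
      (∀ i j, Z i j ∈ (Set.range (translation (G := G))).centralizer) ∧
      (∀ i j, Z' i j ∈ (Set.range (translation (G := G))).centralizer) ∧
      X * L + Z * Z' = 1 ∧ Z' * Z = 1 := by
  let C := Subring.centralizer (Set.range (translation (G := G)))
  let _ : CommRing C :=
    { (inferInstance : Ring C) with
      mul_comm := fun a b => Subtype.ext (mul_comm_of_mem_centralizer hG a.2 b.2) }
  have hC : HasStableRangeOne C := by
    intro a a' b h
    obtain ⟨e, he, hu⟩ := exists_isUnit_add_mul_of_centralizer
      (fun u => star_mem_range_translation) (fun a ha b hb => mul_comm_of_mem_centralizer hG ha hb)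
      a.2 a'.2 b.2 (congrArg Subtype.val h)
    obtain ⟨u, hu⟩ := hu
    have huC : (u : EllTwo G →L[ℂ] EllTwo G) ∈ C := by
      rw [hu]; exact C.add_mem a.2 (C.mul_mem b.2 he)
    -- The commutant is closed under inverses, so a unit among all operators is a unit of `C`.
    have huC' : ((u⁻¹ : (EllTwo G →L[ℂ] EllTwo G)ˣ) : EllTwo G →L[ℂ] EllTwo G) ∈ C :=
      fun m hm => (Commute.units_inv_right (huC m hm : Commute m u)).eq
    refine ⟨⟨e, he⟩, IsUnit.of_mul_eq_one ⟨_, huC'⟩ (Subtype.ext ?_)⟩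
    change ((a : EllTwo G →L[ℂ] EllTwo G) + b * e) * _ = 1
    rw [← hu, Units.mul_inv]
  let φ : C →+* (EllTwo G →L[ℂ] EllTwo G) := C.subtype
  have hφ : Function.Injective φ := Subtype.val_injective
  let X₀ : Matrix (Fin s) (Fin r) C := fun i j => ⟨X i j, hX i j⟩
  let L₀ : Matrix (Fin r) (Fin s) C := fun i j => ⟨L i j, hL i j⟩
  have hX₀ : X₀.map φ = X := rfl
  have hL₀ : L₀.map φ = L := rfl
  obtain ⟨Z, Z', h1, h2⟩ := hC.exists_matrix_complement hrs X₀ L₀ (by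
    apply Matrix.map_injective hφ
    dsimp only
    rw [Matrix.map_mul, hX₀, hL₀, hLX, Matrix.map_one _ (map_zero φ) (map_one φ)])
  refine ⟨Z.map φ, Z'.map φ, fun i j => (Z i j).2, fun i j => (Z' i j).2, ?_, ?_⟩
  · rw [← hX₀, ← hL₀, ← Matrix.map_mul, ← Matrix.map_mul,
      ← Matrix.map_add _ (map_add φ), h1, Matrix.map_one _ (map_zero φ) (map_one φ)]
  · rw [← Matrix.map_mul, h2, Matrix.map_one _ (map_zero φ) (map_one φ)]

end Translation

end EllTwo

open EllTwo

/-! ### Riesz bases, synthesis operators and orbit families. -/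

section Riesz

variable {H : Type*} [NormedAddCommGroup H] [InnerProductSpace ℂ H]

theorem IsRieszBasis.mem {J : Type*} {v : J → H} {V : Submodule ℂ H} (hv : IsRieszBasis v V)
    (j : J) : v j ∈ V := by
  rw [hv.1]
  exact Submodule.le_topologicalClosure _ (Submodule.subset_span ⟨j, rfl⟩)

theorem IsRieszBasis.isClosed {J : Type*} {v : J → H} {V : Submodule ℂ H}
    (hv : IsRieszBasis v V) : IsClosed (V : Set H) := by
  rw [hv.1]
  exact Submodule.isClosed_topologicalClosure _

theorem IsRieszBasis.le_of_forall_mem {J : Type*} {v : J → H} {V W : Submodule ℂ H}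
    (hv : IsRieszBasis v V) (hW : IsClosed (W : Set H)) (h : ∀ j, v j ∈ W) : V ≤ W := by
  rw [hv.1]
  exact Submodule.topologicalClosure_minimal _
    (Submodule.span_le.2 (Set.range_subset_iff.2 h)) hW

/-- The synthesis operator of a Riesz basis. -/
theorem IsRieszBasis.exists_synthesis {J : Type*} {v : J → H} {V : Submodule ℂ H}
    (hv : IsRieszBasis v V) : ∃ T : EllTwo J →L[ℂ] H, ∀ j, T (delta j) = v j := by
  obtain ⟨-, A, B, -, hB, h⟩ := hv
  refine ⟨LinearMap.mkContinuous
    { toFun := fun a => ∑' n, a n • v n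
      map_add' := fun a b => by
        rw [← (h a).1.tsum_add (h b).1]
        exact tsum_congr fun n => add_smul _ _ _
      map_smul' := fun c a => by
        rw [RingHom.id_apply, ← (h a).1.tsum_const_smul]
        exact tsum_congr fun n => by simp [mul_smul] } (Real.sqrt B) (fun a => ?_), fun j => ?_⟩
  · have h2 := (h a).2.2
    rw [(hasSum_norm_sq a).tsum_eq] at h2
    rw [← sq_le_sq₀ (norm_nonneg _) (by positivity), mul_pow, Real.sq_sqrt hB.le]
    exact h2
  · change ∑' n, delta j n • v n = v j
    rw [tsum_eq_single j fun n hn => by rw [delta_apply, if_neg hn.symm, zero_smul], delta_apply,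
      if_pos rfl, one_smul]

/-- A left inverse of the form `T'†` makes the images of the standard basis a Riesz basis. -/
theorem isRieszBasis_of_adjoint_comp_eq_one [CompleteSpace H] {J : Type*} {T T' : EllTwo J →L[ℂ] H}
    {V : Submodule ℂ H} (hV : IsClosed (V : Set H)) (hTV : ∀ j, T (delta j) ∈ V)
    (h : ∀ a, adjoint T' (T a) = a) (hP : ∀ v ∈ V, T (adjoint T' v) = v) :
    IsRieszBasis (fun j => T (delta j)) V := by
  -- The lower bound comes from the left inverse `T'†`; adding `1` to each norm keeps the constants
  -- positive even on trivial spaces.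
  refine ⟨le_antisymm (fun v hv => ?_) (Submodule.topologicalClosure_minimal _
    (Submodule.span_le.2 (Set.range_subset_iff.2 hTV)) hV), ((‖T'‖ + 1) ^ 2)⁻¹, (‖T‖ + 1) ^ 2,
    by positivity, by positivity, fun a => ?_⟩
  · rw [← hP v hv]
    exact apply_mem_of_isClosed (Submodule.isClosed_topologicalClosure _)
      (fun j => Submodule.le_topologicalClosure _ (Submodule.subset_span (Set.mem_range_self j))) _
  · have hT := hasSum_apply T a
    refine ⟨hT.summable, ?_, ?_⟩
    · rw [hT.tsum_eq, (hasSum_norm_sq a).tsum_eq, inv_mul_le_iff₀ (by positivity), ← mul_pow]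
      gcongr
      calc ‖a‖ = ‖adjoint T' (T a)‖ := by rw [h]
        _ ≤ ‖adjoint T'‖ * ‖T a‖ := (adjoint T').le_opNorm _
        _ ≤ (‖T'‖ + 1) * ‖T a‖ := by
          rw [LinearIsometryEquiv.norm_map]
          gcongr
          linarith
    · rw [hT.tsum_eq, (hasSum_norm_sq a).tsum_eq, ← mul_pow]
      gcongr
      refine (T.le_opNorm a).trans ?_
      gcongr
      linarith

section Column

variable {G : Type*} {ι : Type*}

/-- Restriction of an element of `ℓ²(G × ι)` to `G × {i}`. -/
noncomputable def column (i : ι) : EllTwo (G × ι) →L[ℂ] EllTwo G :=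
  comap (fun g => (g, i)) (fun _ _ h => congrArg Prod.fst h)

theorem adjoint_column_delta (i : ι) (g : G) :
    adjoint (column (G := G) i) (delta g) = delta (g, i) :=
  adjoint_comap_delta _ g

theorem column_delta [DecidableEq ι] (i j : ι) (g : G) :
    column i (delta (g, j)) = if j = i then delta g else 0 := by
  refine ext_inner fun h => ?_
  have h0 : column i (delta (g, j)) h = delta (g, j) (h, i) := rfl
  rw [inner_delta_left, inner_delta_left, h0, delta_apply]
  split_ifs with h1 h2 h2 <;> simp_all [delta_apply]

variable [Fintype ι] (T T' : ι → EllTwo G →L[ℂ] H)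

theorem sum_comp_column_delta (g : G) (i : ι) :
    (∑ j, T j ∘L column j) (delta (g, i)) = T i (delta g) := by
  classical
  simp only [sum_apply, comp_apply, column_delta]
  rw [Finset.sum_eq_single i] <;> simp +contextual [eq_comm]

theorem isRieszBasis_columns [CompleteSpace H] [DecidableEq ι] {V : Submodule ℂ H} (hV : IsClosed (V : Set H))
    (hTV : ∀ j g, T j (delta g) ∈ V)
    (h : ∀ i j, adjoint (T' i) ∘L T j = if i = j then 1 else 0)
    (hP : ∀ v ∈ V, ∑ j, T j (adjoint (T' j) v) = v) :
    IsRieszBasis (fun p : G × ι => T p.2 (delta p.1)) V := by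
  have hδ : (fun p : G × ι => T p.2 (delta p.1)) =
      fun p => (∑ j, T j ∘L column j) (delta p) :=
    funext fun p => (sum_comp_column_delta T p.1 p.2).symm
  rw [hδ]
  refine isRieszBasis_of_adjoint_comp_eq_one (T' := ∑ j, T' j ∘L column j) hV
    (fun p => by rw [sum_comp_column_delta]; exact hTV _ _) (fun a => ?_) (fun v hv => ?_)
  · rw [← comp_apply]
    refine DFunLike.congr_fun (f := _ ∘L _) (g := ContinuousLinearMap.id ℂ _)
      (clm_ext fun p => ext_inner fun q => ?_) a
    obtain ⟨g, i⟩ := p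
    obtain ⟨k, j⟩ := q
    rw [comp_apply, adjoint_inner_right, sum_comp_column_delta, sum_comp_column_delta,
      ← adjoint_inner_right, ← comp_apply, h, inner_delta_left, id_apply, inner_delta_left,
      delta_apply]
    split_ifs with h1 h2 h2 <;> simp_all [delta_apply]
  · have hcol : ∀ i w, (∑ j, T j ∘L column j) (adjoint (column i) w) = T i w := by
      intro i w
      rw [← comp_apply]
      refine DFunLike.congr_fun (f := _ ∘L _) (clm_ext fun g => ?_) w
      rw [comp_apply, adjoint_column_delta, sum_comp_column_delta]
    have hadj : adjoint (∑ j, T' j ∘L column j) v =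
        ∑ i, adjoint (column i) (adjoint (T' i) v) := by
      rw [map_sum adjoint, sum_apply]
      simp only [adjoint_comp, comp_apply]
    rw [hadj, map_sum]
    simp only [hcol, hP v hv]

end Column

section Orbit

variable (G : Subgroup (H ≃ₗᵢ[ℂ] H)) {ι : Type*}

theorem exists_synthesis_orbitFamily {x : ι → H} {V : Submodule ℂ H}
    (hx : IsRieszBasis (orbitFamily G x) V) :
    ∃ T : ι → EllTwo G →L[ℂ] H, ∀ j g, T j (delta g) = (g : H ≃ₗᵢ[ℂ] H) (x j) := by
  obtain ⟨T, hT⟩ := hx.exists_synthesis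
  exact ⟨fun j => T ∘L adjoint (column j), fun j g => by
    rw [comp_apply, adjoint_column_delta, hT]; rfl⟩

theorem adjoint_comp_of_biorthogonal [CompleteSpace H] [DecidableEq ι] {x x' : ι → H}
    (h : Biorthogonal (orbitFamily G x) (orbitFamily G x')) {T T' : ι → EllTwo G →L[ℂ] H}
    (hT : ∀ j g, T j (delta g) = (g : H ≃ₗᵢ[ℂ] H) (x j))
    (hT' : ∀ j g, T' j (delta g) = (g : H ≃ₗᵢ[ℂ] H) (x' j)) (i j : ι) :
    adjoint (T i) ∘L T' j = if i = j then 1 else 0 := by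
  refine clm_ext fun g => ext_inner fun k => ?_
  have := h (k, i) (g, j)
  simp only [orbitFamily] at this
  rw [comp_apply, adjoint_inner_right, hT, hT', this, inner_delta_left]
  split_ifs with h1 h2 h2 <;> simp_all [delta_apply, @eq_comm _ g k]

/-- By biorthogonality the operator `∑ Tⱼ T'ⱼ†` fixes every member of the family, and its fixed
vectors form a closed subspace. -/
theorem IsRieszBasis.sum_apply_adjoint_eq_self [CompleteSpace H] [Fintype ι] [DecidableEq ι]
    {x : ι → H} {V : Submodule ℂ H}
    (hx : IsRieszBasis (orbitFamily G x) V) {T T' : ι → EllTwo G →L[ℂ] H}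
    (hT : ∀ j g, T j (delta g) = (g : H ≃ₗᵢ[ℂ] H) (x j))
    (h : ∀ i j, adjoint (T' i) ∘L T j = if i = j then 1 else 0) {v : H} (hv : v ∈ V) :
    ∑ j, T j (adjoint (T' j) v) = v := by
  let P : H →L[ℂ] H := ∑ j, T j ∘L adjoint (T' j)
  have hP : ∀ w, P w = ∑ j, T j (adjoint (T' j) w) := fun w => by simp [P, sum_apply]
  have hle : V ≤ LinearMap.eqLocus P.toLinearMap LinearMap.id := by
    refine hx.le_of_forall_mem (isClosed_eq P.continuous continuous_id) fun p => ?_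
    change P ((p.1 : H ≃ₗᵢ[ℂ] H) (x p.2)) = (p.1 : H ≃ₗᵢ[ℂ] H) (x p.2)
    rw [hP, ← hT]
    simp only [← comp_apply (adjoint _), h]
    rw [Finset.sum_eq_single p.2] <;> simp +contextual
  rw [← hP]
  exact hle hv

theorem apply_translation {x : H} {T : EllTwo G →L[ℂ] H}
    (hT : ∀ g, T (delta g) = (g : H ≃ₗᵢ[ℂ] H) x) (g : G) (a : EllTwo G) :
    T (translation g a) = (g : H ≃ₗᵢ[ℂ] H) (T a) := by
  rw [← comp_apply]
  refine DFunLike.congr_fun (f := _ ∘L _)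
    (g := ((g : H ≃ₗᵢ[ℂ] H).toContinuousLinearEquiv : H →L[ℂ] H) ∘L T) (clm_ext fun k => ?_) a
  rw [comp_apply, translation_delta, hT, comp_apply, hT]
  rfl

theorem adjoint_apply_unitary [CompleteSpace H] {x : H} {T : EllTwo G →L[ℂ] H}
    (hT : ∀ g, T (delta g) = (g : H ≃ₗᵢ[ℂ] H) x) (g : G) (v : H) :
    adjoint T ((g : H ≃ₗᵢ[ℂ] H) v) = translation g (adjoint T v) := by
  refine ext_inner_left ℂ fun a => ?_
  rw [adjoint_inner_right, ← adjoint_inner_left, adjoint_translation, adjoint_inner_right,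
    apply_translation G hT]
  have := LinearIsometryEquiv.inner_map_map (g : H ≃ₗᵢ[ℂ] H) ((g : H ≃ₗᵢ[ℂ] H).symm (T a)) v
  rw [LinearIsometryEquiv.apply_symm_apply] at this
  exact this

/-- `U` intertwines translations with the action of `G`, and `T†` intertwines them back because `G`
acts by unitaries. -/
theorem adjoint_comp_mem_centralizer [CompleteSpace H] {x y : H} {T U : EllTwo G →L[ℂ] H}
    (hT : ∀ g, T (delta g) = (g : H ≃ₗᵢ[ℂ] H) x) (hU : ∀ g, U (delta g) = (g : H ≃ₗᵢ[ℂ] H) y) :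
    adjoint T ∘L U ∈ (Set.range (translation (G := G))).centralizer := by
  rintro _ ⟨g, rfl⟩
  ext1 a
  simp only [mul_apply_eq_comp, comp_apply]
  rw [apply_translation G hU, adjoint_apply_unitary G hT]

end Orbit

end Riesz

/-! ### Operator matrices and complementary biorthogonal systems. -/

section Composition

variable {E H : Type*} [NormedAddCommGroup E] [NormedSpace ℂ E] [NormedAddCommGroup H]
  [NormedSpace ℂ H] {ι κ μ : Type*} [Fintype ι]

/-- Biorthogonality collapses the inner double sum, so composing operators amounts to multiplying
their coefficient matrices. -/
theorem sum_comp_sum_of_biorthogonal [DecidableEq ι] {U : ι → E →L[ℂ] H} {W : ι → H →L[ℂ] E}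
    (hWU : ∀ i j, W i ∘L U j = if i = j then 1 else 0) (N : Matrix μ ι (E →L[ℂ] E))
    (M : Matrix ι κ (E →L[ℂ] E)) (i : μ) (j : κ) :
    (∑ k, N i k ∘L W k) ∘L (∑ l, U l ∘L M l j) = (N * M) i j := by
  ext1 a
  have h : ∀ k l b, W k (U l b) = if k = l then b else 0 := fun k l b => by
    rw [← comp_apply, hWU]
    split_ifs <;> simp
  simp only [Matrix.mul_apply, sum_apply, map_sum, comp_apply, mul_apply_eq_comp, h]
  refine Finset.sum_congr rfl fun l _ => ?_
  rw [Finset.sum_eq_single l] <;> simp +contextual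

theorem sum_sum_comp_comp_sum [Fintype κ] (U : ι → E →L[ℂ] H) (W : ι → H →L[ℂ] E)
    (M : Matrix ι κ (E →L[ℂ] E)) (N : Matrix κ ι (E →L[ℂ] E)) :
    ∑ j, (∑ i, U i ∘L M i j) ∘L (∑ k, N j k ∘L W k) = ∑ i, ∑ k, U i ∘L (M * N) i k ∘L W k := by
  ext1 v
  simp only [Matrix.mul_apply, sum_apply, map_sum, comp_apply, mul_apply_eq_comp]
  rw [Finset.sum_comm]
  conv_rhs => rw [Finset.sum_comm]
  refine Finset.sum_congr rfl fun i _ => ?_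
  rw [Finset.sum_comm]

end Composition

theorem adjoint_comp_comm {E H ι : Type*} [DecidableEq ι] [NormedAddCommGroup E] [InnerProductSpace ℂ E]
    [CompleteSpace E] [NormedAddCommGroup H] [InnerProductSpace ℂ H] [CompleteSpace H]
    {A B : ι → E →L[ℂ] H} (h : ∀ i j, adjoint (A i) ∘L B j = if i = j then 1 else 0) (i j : ι) :
    adjoint (B i) ∘L A j = if i = j then 1 else 0 := by
  have := congrArg adjoint (h j i)
  rw [adjoint_comp, adjoint_adjoint] at this
  rw [this, ← star_eq_adjoint]
  by_cases hij : i = j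
  · simp [hij]
  · simp [hij, Ne.symm hij]

theorem sum_comp_apply_delta {H : Type*} [NormedAddCommGroup H] [InnerProductSpace ℂ H]
    (G : Subgroup (H ≃ₗᵢ[ℂ] H)) {ι : Type*} [Fintype ι] {y : ι → H}
    {U : ι → EllTwo G →L[ℂ] H} (hU : ∀ j g, U j (delta g) = (g : H ≃ₗᵢ[ℂ] H) (y j))
    {M : ι → EllTwo G →L[ℂ] EllTwo G}
    (hM : ∀ i, M i ∈ (Set.range (translation (G := G))).centralizer) (g : G) :
    (∑ i, U i ∘L M i) (delta g) = (g : H ≃ₗᵢ[ℂ] H) ((∑ i, U i ∘L M i) (delta 1)) := by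
  simp only [sum_apply, comp_apply, map_sum]
  refine Finset.sum_congr rfl fun i _ => ?_
  rw [apply_delta_of_mem_centralizer (hM i), apply_translation G (hU i)]

section Complement

variable {E H : Type*} [NormedAddCommGroup E] [InnerProductSpace ℂ E] [CompleteSpace E]
  [NormedAddCommGroup H] [InnerProductSpace ℂ H] [CompleteSpace H] {ι κ μ : Type*} [Fintype κ]
  {T T' : ι → E →L[ℂ] H} {U U' : κ → E →L[ℂ] H}

theorem adjoint_eq_sum_comp (hT' : ∀ j, ∑ i, U' i ∘L adjoint (U i) ∘L T' j = T' j) (j : ι) :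
    adjoint (T' j) = ∑ k, (adjoint (T' j) ∘L U k) ∘L adjoint (U' k) := by
  conv_lhs => rw [← hT' j, map_sum]
  simp only [adjoint_comp, adjoint_adjoint]

variable [DecidableEq ι] [DecidableEq κ]

/-- This is `T'† T = 1` with the reproducing sum `∑ Uₖ U'ₖ†` inserted in the middle. -/
theorem matrix_adjoint_comp_mul_eq_one
    (hTT : ∀ i j, adjoint (T' i) ∘L T j = if i = j then 1 else 0)
    (hUU : ∀ i j, adjoint (U' i) ∘L U j = if i = j then 1 else 0)
    (hT : ∀ j, ∑ i, U i ∘L adjoint (U' i) ∘L T j = T j)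
    (hT' : ∀ j, ∑ i, U' i ∘L adjoint (U i) ∘L T' j = T' j) :
    (Matrix.of fun i j => adjoint (T' i) ∘L U j) * (Matrix.of fun i j => adjoint (U' i) ∘L T j) =
      (1 : Matrix ι ι (E →L[ℂ] E)) := by
  ext1 i j
  rw [← sum_comp_sum_of_biorthogonal hUU, Matrix.one_apply, ← hTT, adjoint_eq_sum_comp hT' i]
  congr 1
  exact hT j

/-- Completing the coefficient matrix of `T` with respect to `U` to an invertible matrix produces
a biorthogonal system complementary to `T, T'`. -/
theorem complementary_system_of_matrix [Fintype ι] [Fintype μ] [DecidableEq μ]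
    (hTT : ∀ i j, adjoint (T' i) ∘L T j = if i = j then 1 else 0)
    (hUU : ∀ i j, adjoint (U' i) ∘L U j = if i = j then 1 else 0)
    (hT : ∀ j, ∑ i, U i ∘L adjoint (U' i) ∘L T j = T j)
    (hT' : ∀ j, ∑ i, U' i ∘L adjoint (U i) ∘L T' j = T' j)
    {M : Matrix κ μ (E →L[ℂ] E)} {N : Matrix μ κ (E →L[ℂ] E)}
    (hMN : (Matrix.of fun i j => adjoint (U' i) ∘L T j) *
      (Matrix.of fun i j => adjoint (T' i) ∘L U j) + M * N = 1) (hNM : N * M = 1)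
    {Z Z' : μ → E →L[ℂ] H} (hZ : ∀ j, Z j = ∑ i, U i ∘L M i j)
    (hZ' : ∀ j, Z' j = ∑ i, U' i ∘L adjoint (N j i)) :
    (∀ i j, adjoint (Z' i) ∘L Z j = if i = j then 1 else 0) ∧
    (∀ i j, adjoint (T' i) ∘L Z j = 0) ∧ (∀ i j, adjoint (Z' i) ∘L T j = 0) ∧
    ∑ j, T j ∘L adjoint (T' j) + ∑ j, Z j ∘L adjoint (Z' j) = ∑ j, U j ∘L adjoint (U' j) := by
  have hLX := matrix_adjoint_comp_mul_eq_one hTT hUU hT hT'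
  obtain ⟨X, hX⟩ : ∃ X : Matrix κ ι (E →L[ℂ] E), X = .of fun i j => adjoint (U' i) ∘L T j :=
    ⟨_, rfl⟩
  obtain ⟨L, hL⟩ : ∃ L : Matrix ι κ (E →L[ℂ] E), L = .of fun i j => adjoint (T' i) ∘L U j :=
    ⟨_, rfl⟩
  rw [← hX, ← hL] at hLX hMN
  have hTX : ∀ j, T j = ∑ i, U i ∘L X i j := fun j => by rw [hX]; exact (hT j).symm
  have hTL : ∀ j, adjoint (T' j) = ∑ k, L j k ∘L adjoint (U' k) := fun j => by
    rw [hL]; exact adjoint_eq_sum_comp hT' j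
  -- Multiplying `X L + M N = 1` by `N` on the left and `X` on the right gives `N X + N X = N X`; `L
  -- M = 0` follows in the same way.
  have hNX : N * X = 0 := by
    have h := congrArg (fun A => N * A * X) hMN
    simp only [Matrix.mul_add, Matrix.add_mul, Matrix.mul_one, Matrix.mul_assoc, hLX] at h
    rw [← Matrix.mul_assoc N M, hNM, Matrix.one_mul] at h
    simpa using h
  have hLM : L * M = 0 := by
    have h := congrArg (fun A => L * A * M) hMN
    simp only [Matrix.mul_add, Matrix.add_mul, Matrix.mul_one, Matrix.mul_assoc, hNM] at h
    rw [← Matrix.mul_assoc L X, hLX, Matrix.one_mul] at h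
    simpa using h
  have hZN : ∀ j, adjoint (Z' j) = ∑ k, N j k ∘L adjoint (U' k) := fun j => by
    simp only [hZ', map_sum, adjoint_comp, adjoint_adjoint]
  refine ⟨fun i j => ?_, fun i j => ?_, fun i j => ?_, ?_⟩
  · rw [hZN, hZ, sum_comp_sum_of_biorthogonal hUU N M, hNM, Matrix.one_apply]
  · rw [hTL, hZ, sum_comp_sum_of_biorthogonal hUU L M, hLM, Matrix.zero_apply]
  · rw [hZN, hTX, sum_comp_sum_of_biorthogonal hUU N X, hNX, Matrix.zero_apply]
  · have h1 : ∑ j, T j ∘L adjoint (T' j) =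
        ∑ i, ∑ k, U i ∘L (X * L) i k ∘L adjoint (U' k) := by
      simp only [hTL]
      conv_lhs => enter [2, j]; rw [hTX j]
      exact sum_sum_comp_comp_sum U _ X L
    have h2 : ∑ j, Z j ∘L adjoint (Z' j) =
        ∑ i, ∑ k, U i ∘L (M * N) i k ∘L adjoint (U' k) := by
      simp only [hZN, hZ]
      exact sum_sum_comp_comp_sum U _ M N
    rw [h1, h2, ← Finset.sum_add_distrib]
    refine Finset.sum_congr rfl fun i _ => ?_
    rw [← Finset.sum_add_distrib]
    simp only [← comp_add, ← add_comp, ← Matrix.add_apply, hMN, Matrix.one_apply]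
    rw [Finset.sum_eq_single i]
    · rw [if_pos rfl]; rfl
    · intro k _ hk
      simp [hk.symm]
    · simp

end Complement

/-- The orbit families of a complementary biorthogonal system form Riesz bases of `V₁ ⊓ V₀'ᗮ`
and, joined to the original one, of `V₁`. -/
theorem isRieszBasis_complement {H : Type*} [NormedAddCommGroup H] [InnerProductSpace ℂ H]
    [CompleteSpace H] {G ι κ : Type*} [Fintype ι] [Fintype κ] [DecidableEq ι] [DecidableEq κ]
    {T T' : ι → EllTwo G →L[ℂ] H} {Z Z' : κ → EllTwo G →L[ℂ] H} {V₀' V₁ : Submodule ℂ H}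
    (hV₁ : IsClosed (V₁ : Set H))
    (hT : ∀ j g, T j (delta g) ∈ V₁) (hT' : ∀ j g, T' j (delta g) ∈ V₀')
    (hZ : ∀ j g, Z j (delta g) ∈ V₁)
    (hTT : ∀ i j, adjoint (T' i) ∘L T j = if i = j then 1 else 0)
    (hZZ : ∀ i j, adjoint (Z' i) ∘L Z j = if i = j then 1 else 0)
    (hTZ : ∀ i j, adjoint (T' i) ∘L Z j = 0) (hZT : ∀ i j, adjoint (Z' i) ∘L T j = 0)
    (hV₀' : ∀ v ∈ V₀', ∑ j, T' j (adjoint (T j) v) = v)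
    (hP : ∀ v ∈ V₁, ∑ j, T j (adjoint (T' j) v) + ∑ j, Z j (adjoint (Z' j) v) = v) :
    (∀ j g, Z j (delta g) ∈ V₁ ⊓ V₀'ᗮ) ∧
    IsRieszBasis (fun p : G × κ => Z p.2 (delta p.1)) (V₁ ⊓ V₀'ᗮ) ∧
    IsRieszBasis (fun p : G × (ι ⊕ κ) => Sum.elim T Z p.2 (delta p.1)) V₁ := by
  have hmem : ∀ j g, Z j (delta g) ∈ V₁ ⊓ V₀'ᗮ := by
    refine fun j g => ⟨hZ j g, fun v hv => ?_⟩
    rw [← hV₀' v hv, sum_inner]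
    refine Finset.sum_eq_zero fun i _ => ?_
    rw [← adjoint_inner_right, ← comp_apply (adjoint _) (Z j), hTZ, zero_apply, inner_zero_right]
  refine ⟨hmem, isRieszBasis_columns Z Z' (hV₁.inter (Submodule.isClosed_orthogonal _)) hmem hZZ
    fun v hv => ?_, isRieszBasis_columns (Sum.elim T Z) (Sum.elim T' Z') hV₁ ?_ ?_ ?_⟩
  · have h0 : ∀ j, adjoint (T' j) v = 0 := fun j => ext_inner fun g => by
      rw [adjoint_inner_right, hv.2 _ (hT' j g), inner_zero_right]
    simpa [h0] using hP v hv.1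
  · rintro (j | j) g
    · exact hT j g
    · exact hZ j g
  · rintro (i | i) (j | j)
    · simpa using hTT i j
    · simpa using hTZ i j
    · simpa using hZT i j
    · simpa using hZZ i j
  · intro v hv
    simpa using hP v hv

/-! ### The main theorem. -/

theorem corollary3p4 {H : Type*} [NormedAddCommGroup H] [InnerProductSpace ℂ H]
    [CompleteSpace H] [TopologicalSpace.SeparableSpace H]
    (G : Subgroup (H ≃ₗᵢ[ℂ] H)) [Countable G] [Infinite G]
    (hG : ∀ g ∈ G, ∀ h ∈ G, g * h = h * g)
    {r s : ℕ} (hrs : r < s)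
    (x x' : Fin r → H) (y y' : Fin s → H)
    (V₀ V₀' V₁ V₁' : Submodule ℂ H)
    (hX : IsRieszBasis (orbitFamily G x) V₀)
    (hX' : IsRieszBasis (orbitFamily G x') V₀')
    (hY : IsRieszBasis (orbitFamily G y) V₁)
    (hY' : IsRieszBasis (orbitFamily G y') V₁')
    (hXX' : Biorthogonal (orbitFamily G x) (orbitFamily G x'))
    (hYY' : Biorthogonal (orbitFamily G y) (orbitFamily G y'))
    (hV : V₀ ≤ V₁) (hV' : V₀' ≤ V₁')
    (W₀ W₀' : Submodule ℂ H) (hW : W₀ = V₁ ⊓ V₀'ᗮ) (hW' : W₀' = V₁' ⊓ V₀ᗮ) :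
    ∃ z z' : Fin (s - r) → H,
      ((∀ j, z j ∈ W₀) ∧
        IsRieszBasis (orbitFamily G z) W₀ ∧
        IsRieszBasis (orbitFamily G (Sum.elim x z)) V₁) ∧
      ((∀ j, z' j ∈ W₀') ∧
        IsRieszBasis (orbitFamily G z') W₀' ∧
        IsRieszBasis (orbitFamily G (Sum.elim x' z')) V₁' ∧
        Biorthogonal (orbitFamily G z') (orbitFamily G z)) := by
  classical
  subst hW hW'
  obtain ⟨T, hT⟩ := exists_synthesis_orbitFamily G hX
  obtain ⟨T', hT'⟩ := exists_synthesis_orbitFamily G hX'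
  obtain ⟨U, hU⟩ := exists_synthesis_orbitFamily G hY
  obtain ⟨U', hU'⟩ := exists_synthesis_orbitFamily G hY'
  have hTT := adjoint_comp_of_biorthogonal G hXX' hT hT'
  have hTT' := adjoint_comp_comm hTT
  have hUU := adjoint_comp_of_biorthogonal G hYY' hU hU'
  have hUU' := adjoint_comp_comm hUU
  have hPT : ∀ v ∈ V₁, ∑ j, U j (adjoint (U' j) v) = v := fun v hv =>
    hY.sum_apply_adjoint_eq_self G hU hUU' hv
  have hPT' : ∀ v ∈ V₁', ∑ j, U' j (adjoint (U j) v) = v := fun v hv =>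
    hY'.sum_apply_adjoint_eq_self G hU' hUU hv
  have hTmem : ∀ j g, T j (delta g) ∈ V₀ := fun j g => hT j g ▸ hX.mem (g, j)
  have hTmem' : ∀ j g, T' j (delta g) ∈ V₀' := fun j g => hT' j g ▸ hX'.mem (g, j)
  have hUmem : ∀ j g, U j (delta g) ∈ V₁ := fun j g => hU j g ▸ hY.mem (g, j)
  have hUmem' : ∀ j g, U' j (delta g) ∈ V₁' := fun j g => hU' j g ▸ hY'.mem (g, j)
  have hUT : ∀ j, ∑ i, U i ∘L adjoint (U' i) ∘L T j = T j := fun j => clm_ext fun g => by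
    rw [sum_apply]
    exact hPT _ (hV (hTmem j g))
  have hUT' : ∀ j, ∑ i, U' i ∘L adjoint (U i) ∘L T' j = T' j := fun j => clm_ext fun g => by
    rw [sum_apply]
    exact hPT' _ (hV' (hTmem' j g))
  obtain ⟨M, N, hM, hN, hMN, hNM⟩ := EllTwo.exists_matrix_complement
    (fun g h => Subtype.ext (hG g g.2 h h.2)) hrs.le _ _
    (fun i j => adjoint_comp_mem_centralizer G (hU' i) (hT j))
    (fun i j => adjoint_comp_mem_centralizer G (hT' i) (hU j))
    (matrix_adjoint_comp_mul_eq_one hTT' hUU' hUT hUT')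
  let Z : Fin (s - r) → EllTwo G →L[ℂ] H := fun j => ∑ i, U i ∘L M i j
  let Z' : Fin (s - r) → EllTwo G →L[ℂ] H := fun j => ∑ i, U' i ∘L adjoint (N j i)
  obtain ⟨hZZ', hTZ, hZT, hsum⟩ := complementary_system_of_matrix hTT' hUU' hUT hUT' hMN hNM
    (Z := Z) (Z' := Z') (fun _ => rfl) (fun _ => rfl)
  have hsum' : ∑ j, T' j ∘L adjoint (T j) + ∑ j, Z' j ∘L adjoint (Z j) =
      ∑ j, U' j ∘L adjoint (U j) := by
    simpa only [map_add, map_sum, adjoint_comp, adjoint_adjoint] using congrArg adjoint hsum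
  -- The entries of `M` commute with translations, so `Z j` is the synthesis operator of the orbit
  -- of `z j = Z j (delta 1)`.
  have hZorbit : ∀ j g, Z j (delta g) = (g : H ≃ₗᵢ[ℂ] H) (Z j (delta 1)) :=
    fun j => sum_comp_apply_delta G hU fun i => hM i j
  have hZorbit' : ∀ j g, Z' j (delta g) = (g : H ≃ₗᵢ[ℂ] H) (Z' j (delta 1)) :=
    fun j => sum_comp_apply_delta G hU' fun i =>
      star_mem_centralizer_of_star_mem (fun _ => star_mem_range_translation) (hN j i)
  have hZmem : ∀ j a, Z j a ∈ V₁ := fun j a => by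
    simp only [Z, sum_apply]
    exact V₁.sum_mem fun i _ => apply_mem_of_isClosed hY.isClosed (hUmem i) _
  have hZmem' : ∀ j a, Z' j a ∈ V₁' := fun j a => by
    simp only [Z', sum_apply]
    exact V₁'.sum_mem fun i _ => apply_mem_of_isClosed hY'.isClosed (hUmem' i) _
  obtain ⟨h1, h2, h3⟩ := isRieszBasis_complement (V₀' := V₀') hY.isClosed
    (fun j g => hV (hTmem j g)) hTmem' (fun j g => hZmem j _) hTT' hZZ' hTZ hZT
    (fun v hv => hX'.sum_apply_adjoint_eq_self G hT' hTT hv) (fun v hv => by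
      simpa [sum_apply, hPT v hv] using DFunLike.congr_fun hsum v)
  -- The dual half exchanges primed and unprimed systems; its relations are the adjoints of those
  -- already obtained.
  obtain ⟨h1', h2', h3'⟩ := isRieszBasis_complement (V₀' := V₀) hY'.isClosed
    (fun j g => hV' (hTmem' j g)) hTmem (fun j g => hZmem' j _) hTT (adjoint_comp_comm hZZ')
    (fun i j => by simpa [adjoint_comp] using congrArg adjoint (hZT j i))
    (fun i j => by simpa [adjoint_comp] using congrArg adjoint (hTZ j i))
    (fun v hv => hX.sum_apply_adjoint_eq_self G hT hTT' hv) (fun v hv => by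
      simpa [sum_apply, hPT' v hv] using DFunLike.congr_fun hsum' v)
  have hfam : orbitFamily G (fun j => Z j (delta 1)) = fun p => Z p.2 (delta p.1) :=
    funext fun p => (hZorbit p.2 p.1).symm
  have hfam' : orbitFamily G (fun j => Z' j (delta 1)) = fun p => Z' p.2 (delta p.1) :=
    funext fun p => (hZorbit' p.2 p.1).symm
  refine ⟨fun j => Z j (delta 1), fun j => Z' j (delta 1),
    ⟨fun j => h1 j 1, hfam ▸ h2, ?_⟩, fun j => h1' j 1, hfam' ▸ h2', ?_, ?_⟩
  · convert h3 using 1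
    ext ⟨g, j | j⟩
    · exact (hT j g).symm
    · exact (hZorbit j g).symm
  · convert h3' using 1
    ext ⟨g, j | j⟩
    · exact (hT' j g).symm
    · exact (hZorbit' j g).symm
  · rw [hfam, hfam']
    rintro ⟨g, i⟩ ⟨h, j⟩
    rw [← adjoint_inner_right, ← comp_apply, hZZ', inner_delta_left]
    by_cases hij : i = j
    · by_cases hgh : g = h
      · simp [hij, hgh, delta_apply]
      · simp [hij, hgh, Ne.symm hgh, delta_apply]
    · simp [hij]
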